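/- **Theorem (rate-distortion sample complexity bounds).** *Setting.* Let $(\Omega,\mathbb F,\mathbb P)$ be a probability space, let the input space $\mathcal X$ and the output space $\mathcal Y$ be standard Borel spaces (for instance finite-dimensional real vector spaces, or finite sets), and let $\mathcal E$ be a random environment: a random element of a measurable space of environments, each of which prescribes a probability distribution $\mathcal E(\cdot\mid x)$ on $\mathcal Y$ to each input $x$, jointly measurably in the environment and $x$. Let $X_0,X_1,\dots$ be iid inputs, $Y_1,Y_2,\dots$ outputs, and $H_t=(X_0,Y_1,\dots,X_{t-1},Y_t,X_t)$. For all $t\ge 0$, $X_t$ is independent of $(\mathcal E,X_0,Y_1,\dots,X_{t-1},Y_t)$, and $\mathbb P(Y_{t+1}\in\cdot\mid\mathcal E,H_t)=\mathcal E(\cdot\mid X_t)=:P^*_t$. *Regret and sample complexity.* An agent $\pi$ predicts $Y_{t+1}$ by a probability distribution $P_t=\pi_t(H_t)$ on $\mathcal Y$ that depends measurably on $H_t$. For $T\in\{0,1,2,\dots\}$ the optimal regret is $$\mathcal R(T)=\inf_\pi\ \mathbb E\Big[\sum_{t=0}^{T-1}D_{\mathrm{KL}}(P^*_t\,\|\,P_t)\Big]\in[0,\infty],$$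 and for $\epsilon\ge 0$ the sample complexity is $T_\epsilon=\min\{T\in\{1,2,\dots\}:\mathcal R(T)/T\le\epsilon\}$, with $T_\epsilon=\infty$ if there is no such $T$. *Rate-distortion function.* An environment proxy is a random variable $\tilde{\mathcal E}$, with values in any measurable space, such that $\tilde{\mathcal E}\perp(X_t,Y_{t+1})_{t\ge0}\mid\mathcal E$; it is defined on the given probability space enlarged by a uniform random variable on $[0,1]$ that is independent of everything in it, so it may use auxiliary randomness. Let $(X,Y)=(X_0,Y_1)$, $P^*=\mathcal E(\cdot\mid X)$ and $\tilde P=\mathbb P(Y\in\cdot\mid\tilde{\mathcal E},X)$. For $\epsilon\ge0$, $$\mathbb H_\epsilon(\mathcal E)=\inf\big\{\mathbb I(\mathcal E;\tilde{\mathcal E}) : \tilde{\mathcal E}\text{ an environment proxy with } \mathbb E[D_{\mathrm{KL}}(P^*\,\|\,\tilde P)]\le\epsilon\big\}\in[0,\infty],$$ where $\mathbb I$ is mutual information, in nats. *Claim.* For all $\epsilon\ge0$, $$\frac{\mathbb H_\epsilon(\mathcal E)}{\epsilon}\ \le\ T_\epsilon\ \le\ \max\Big\{1,\ \inf_{\delta\in[0,\epsilon]}\Big\lceil\frac{\mathbb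 H_{\epsilon-\delta}(\mathcal E)}{\delta}\Big\rceil\Big\} \qquad\text{and}\qquad \inf_{\delta\in[0,\epsilon]}\Big\lceil\frac{\mathbb H_{\epsilon-\delta}(\mathcal E)}{\delta}\Big\rceil\ \le\ \Big\lceil\frac{2\,\mathbb H_{\epsilon/2}(\mathcal E)}{\epsilon}\Big\rceil .$$ Here values may be $\infty$, $a/0=\infty$ for $a>0$, $0/0=0$, and $\lceil\infty\rceil=\infty$. -/

import Mathlib

open MeasureTheory ProbabilityTheory InformationTheory
open scoped ENNReal NNReal unitInterval

universe u v

namespace RateDistortion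

noncomputable section

/-- The space of histories `H_t = (X_0, Y_1, …, X_{t-1}, Y_t, X_t)`. -/
abbrev History (𝒳 𝒴 : Type u) (t : ℕ) : Type u := (Fin t → 𝒳 × 𝒴) × 𝒳

/-- A data generating process on the probability space `(Ω, P)`.  The random environment is
`E : Ω → Θ`; the environment `θ : Θ` prescribes to the input `x` the distribution `env (θ, x)` of
the output.  `X t` is the `t`-th input, and `Y (t + 1)` is the output that corresponds to it
(`Y 0` plays no role). -/
structure DataProcess {Ω : Type v} [MeasurableSpace Ω] (P : Measure Ω)
    (Θ 𝒳 𝒴 : Type u) [MeasurableSpace Θ] [MeasurableSpace 𝒳] [MeasurableSpace 𝒴] where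
  /-- the conditional output distributions -/
  env : Kernel (Θ × 𝒳) 𝒴
  env_markov : IsMarkovKernel env
  /-- the random environment -/
  E : Ω → Θ
  /-- the inputs -/
  X : ℕ → Ω → 𝒳
  /-- the outputs -/
  Y : ℕ → Ω → 𝒴
  measurable_E : Measurable E
  measurable_X : ∀ t, Measurable (X t)
  measurable_Y : ∀ t, Measurable (Y t)
  /-- the inputs are independent … -/
  iIndep_X : iIndepFun X P
  /-- … and identically distributed -/
  ident_X : ∀ t, IdentDistrib (X t) (X 0) P P
  /-- `X_t` is independent of the environment and the data `X_0, Y_1, …, X_{t-1}, Y_t` -/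
  indep_X_past : ∀ t : ℕ,
    IndepFun (X t) (fun ω => (E ω, fun i : Fin t => (X i ω, Y (i + 1) ω))) P
  /-- the distribution of `Y_{t+1}` conditioned on the environment and `H_t` is `env (E, X_t)` -/
  condDistrib_Y : ∀ t : ℕ,
    HasCondDistrib (Y (t + 1))
      (fun ω => (E ω, ((fun i : Fin t => (X i ω, Y (i + 1) ω), X t ω) : History 𝒳 𝒴 t)))
      (env.comap (fun p : Θ × History 𝒳 𝒴 t => (p.1, p.2.2)) (by fun_prop)) P

/-- An agent: a measurable map `π_t` from histories `H_t` to predictive distributions, for each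
time `t`. -/
structure Agent (𝒳 𝒴 : Type u) [MeasurableSpace 𝒳] [MeasurableSpace 𝒴] where
  /-- the prediction rule at time `t` -/
  predict : (t : ℕ) → Kernel (History 𝒳 𝒴 t) 𝒴
  predict_markov : ∀ t, IsMarkovKernel (predict t)

/-- The mutual information `I(A; B)` in nats: the Kullback-Leibler divergence of the joint law
from the product of the marginal laws. -/
def mutualInfo {Ω α β : Type*} [MeasurableSpace Ω] [MeasurableSpace α] [MeasurableSpace β]
    (P : Measure Ω) (A : Ω → α) (B : Ω → β) : ℝ≥0∞ :=
  klDiv (P.map (fun ω => (A ω, B ω))) ((P.map A).prod (P.map B))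

/-- `A` and `B` are conditionally independent given `C`:
`P(A ∈ s, B ∈ t | C) = P(A ∈ s | C) P(B ∈ t | C)` almost surely, for all measurable `s`, `t`. -/
def CondIndepGiven {Ω α β γ : Type*} [MeasurableSpace Ω] [MeasurableSpace α] [MeasurableSpace β]
    [mγ : MeasurableSpace γ] (P : Measure Ω) (A : Ω → α) (B : Ω → β) (C : Ω → γ) : Prop :=
  ∀ (s : Set α) (t : Set β), MeasurableSet s → MeasurableSet t →
    P⟦A ⁻¹' s ∩ B ⁻¹' t | mγ.comap C⟧ =ᵐ[P] P⟦A ⁻¹' s | mγ.comap C⟧ * P⟦B ⁻¹' t | mγ.comap C⟧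

namespace DataProcess

variable {Ω : Type v} [MeasurableSpace Ω] {P : Measure Ω}
  {Θ 𝒳 𝒴 : Type u} [MeasurableSpace Θ] [MeasurableSpace 𝒳] [MeasurableSpace 𝒴]

/-- The history `H_t` as a random variable. -/
def history (D : DataProcess P Θ 𝒳 𝒴) (t : ℕ) (ω : Ω) : History 𝒳 𝒴 t :=
  (fun i : Fin t => (D.X i ω, D.Y (i + 1) ω), D.X t ω)

/-- The whole sequence of data pairs `(X_t, Y_{t+1})`. -/
def data (D : DataProcess P Θ 𝒳 𝒴) (ω : Ω) : ℕ → 𝒳 × 𝒴 :=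
  fun t => (D.X t ω, D.Y (t + 1) ω)

/-- The target distribution `P*_t = env (E, X_t)`. -/
def target (D : DataProcess P Θ 𝒳 𝒴) (t : ℕ) (ω : Ω) : Measure 𝒴 := D.env (D.E ω, D.X t ω)

/-- The expected cumulative error of the agent `π` over the duration `T`. -/
def agentRegret (D : DataProcess P Θ 𝒳 𝒴) (π : Agent 𝒳 𝒴) (T : ℕ) : ℝ≥0∞ :=
  ∫⁻ ω, ∑ t ∈ Finset.range T, klDiv (D.target t ω) (π.predict t (D.history t ω)) ∂P

/-- The optimal regret `R(T)`. -/
def regret (D : DataProcess P Θ 𝒳 𝒴) (T : ℕ) : ℝ≥0∞ := ⨅ π : Agent 𝒳 𝒴, D.agentRegret π T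

/-- The sample complexity: the least duration `T ≥ 1` such that `R(T) / T ≤ ε` (`⊤` if there is
none). -/
def sampleComplexity (D : DataProcess P Θ 𝒳 𝒴) (ε : ℝ≥0) : ℕ∞ :=
  sInf {N : ℕ∞ | ∃ T : ℕ, N = T ∧ 1 ≤ T ∧ D.regret T / T ≤ ε}

/-- The probability measure of the space `Ω × [0, 1]`, on which environment proxies live: the given
probability space, together with a uniform random variable that is independent of everything in
it.  (Proxies may use auxiliary randomness, such as a conditionally independent copy of data.) -/
abbrev extended (P : Measure Ω) : Measure (Ω × I) := P.prod volume

/-- `Z` is an environment proxy: a random variable that is independent of the inputs and outputs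
conditioned on the environment. -/
structure IsProxy (D : DataProcess P Θ 𝒳 𝒴) {W : Type*} [MeasurableSpace W]
    (Z : Ω × I → W) : Prop where
  measurable : Measurable Z
  condIndep : CondIndepGiven (extended P) Z (fun ω => D.data ω.1) (fun ω => D.E ω.1)

/-- The distortion `E[D_KL(P* ‖ P̃)]` of the proxy `Z`, where `P̃` is the distribution of the
output conditioned on `Z` and on the input, for the representative pair `(X_0, Y_1)`. -/
def distortion [IsFiniteMeasure P] [StandardBorelSpace 𝒴] [Nonempty 𝒴]
    (D : DataProcess P Θ 𝒳 𝒴) {W : Type*} [MeasurableSpace W] (Z : Ω × I → W) : ℝ≥0∞ :=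
  ∫⁻ ω, klDiv (D.target 0 ω.1)
    (condDistrib (fun ω => D.Y 1 ω.1) (fun ω => (Z ω, D.X 0 ω.1)) (extended P) (Z ω, D.X 0 ω.1))
    ∂(extended P)

/-- The rate-distortion function: the infimum of the rate `I(E; Z)` over all proxies `Z` whose
distortion is at most `ε`. -/
def rateDistortion [IsFiniteMeasure P] [StandardBorelSpace 𝒴] [Nonempty 𝒴]
    (D : DataProcess P Θ 𝒳 𝒴) (ε : ℝ≥0) : ℝ≥0∞ :=
  ⨅ (W : Type u) (_ : MeasurableSpace W) (Z : Ω × I → W) (_ : D.IsProxy Z)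
    (_ : D.distortion Z ≤ ε), mutualInfo (extended P) (fun ω => D.E ω.1) Z

end DataProcess

end

end RateDistortion

/-! By the chain rule, the error of an agent over `T` rounds is the divergence of the law of (`E`,
first `T` pairs) from the product of the law of `E` with the data law that the agent's predictions
generate (`agentRegret_eq`). Both bounds on `T_ε` compare this divergence with mutual information.

Upper bound: given a proxy `Z` and a predictor `κ(Z, X)`, let the agent be Bayesian for the model
"`Z` from its marginal, then outputs from `κ(Z, ·)`". Retaining `Z` in both laws can only increase
the divergence, and the chain rule then evaluates it as `I(E; Z)` plus `T` times the one-step error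
(`IsProxy.regret_le`). Hence `R(T) ≤ H_{ε-δ} + T (ε - δ)`, which is at most `T ε` once `T ≥ H_{ε-δ}
/ δ`.

Lower bound: let `Z` be a fresh copy of the first `T` pairs, conditionally independent of the data
given `E` (`exists_proxy`). Among product reference measures with first factor the law of `E`, the
product of the marginals minimizes the divergence, so `I(E; Z) ≤ R(T)`. At each round an agent sees
only part of such a sample, so it does no better than prediction from all of `Z`, and `T` times the
distortion is at most `R(T)`. If `R(T) / T ≤ ε`, then `Z` is admissible and `H_ε ≤ R(T) ≤ ε T`. -/

namespace RateDistortion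

/-! ### Divergence of kernels and composition products -/

section Divergence

variable {α β γ : Type*} [MeasurableSpace α] [MeasurableSpace β] [MeasurableSpace γ]

lemma klDiv_map_measurableEquiv (e : α ≃ᵐ β) (μ ν : Measure α) [IsFiniteMeasure μ]
    [IsFiniteMeasure ν] : klDiv (μ.map e) (ν.map e) = klDiv μ ν := by
  refine le_antisymm (klDiv_map_le μ ν e.measurable) ?_
  simpa using klDiv_map_le (μ.map e) (ν.map e) e.symm.measurable

lemma klDiv_kernel_eq [MeasurableSpace.CountableOrCountablyGenerated α β]
    (κ η : Kernel α β) [IsFiniteKernel κ] [IsFiniteKernel η] {a : α} (h : κ a ≪ η a) :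
    klDiv (κ a) (η a) = ∫⁻ b, ENNReal.ofReal (klFun (κ.rnDeriv η a b).toReal) ∂(η a) := by
  rw [klDiv_eq_lintegral_klFun_of_ac h]
  refine lintegral_congr_ae ?_
  filter_upwards [κ.rnDeriv_eq_rnDeriv_measure (η := η) (a := a)] with b hb
  rw [hb]

/-- Absolute continuity holds on a measurable set of parameters. There the jointly measurable kernel
density gives an integral formula; elsewhere the divergence is infinite. -/
lemma measurable_klDiv [MeasurableSpace.CountableOrCountablyGenerated α β]
    (κ η : Kernel α β) [IsFiniteKernel κ] [IsFiniteKernel η] :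
    Measurable fun a => klDiv (κ a) (η a) := by
  classical
  have h : (fun a => klDiv (κ a) (η a)) = fun a => if κ a ≪ η a then
      ∫⁻ b, ENNReal.ofReal (klFun (κ.rnDeriv η a b).toReal) ∂(η a) else ∞ := by
    ext a
    split_ifs with ha
    · exact klDiv_kernel_eq κ η ha
    · exact klDiv_of_not_ac ha
  rw [h]
  refine Measurable.ite (Kernel.measurableSet_absolutelyContinuous κ η) ?_ measurable_const
  refine Measurable.lintegral_kernel_prod_right' (κ := η)
    (f := fun p : α × β => ENNReal.ofReal (klFun (κ.rnDeriv η p.1 p.2).toReal)) ?_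
  have := Kernel.measurable_rnDeriv κ η
  fun_prop

lemma compProd_eq_withDensity [MeasurableSpace.CountableOrCountablyGenerated α β]
    (μ : Measure α) [SFinite μ] (κ η : Kernel α β) [IsFiniteKernel κ] [IsFiniteKernel η]
    (h : ∀ᵐ a ∂μ, κ a ≪ η a) :
    μ ⊗ₘ κ = (μ ⊗ₘ η).withDensity (fun p => κ.rnDeriv η p.1 p.2) := by
  have hm := Kernel.measurable_rnDeriv κ η
  ext s hs
  rw [Measure.compProd_apply hs, withDensity_apply _ hs, ← lintegral_indicator hs,
    Measure.lintegral_compProd (hm.indicator hs)]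
  refine lintegral_congr_ae ?_
  filter_upwards [h] with a ha
  rw [← Kernel.setLIntegral_rnDeriv ha (measurable_prodMk_left hs),
    ← lintegral_indicator (measurable_prodMk_left hs)]
  rfl

/-- The divergence of two composition products with the same first marginal is the expected
divergence of the kernels. -/
lemma klDiv_compProd_right [MeasurableSpace.CountableOrCountablyGenerated α β]
    (μ : Measure α) [IsFiniteMeasure μ] (κ η : Kernel α β) [IsMarkovKernel κ] [IsMarkovKernel η] :
    klDiv (μ ⊗ₘ κ) (μ ⊗ₘ η) = ∫⁻ a, klDiv (κ a) (η a) ∂μ := by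
  have hm := Kernel.measurable_rnDeriv κ η
  by_cases h : ∀ᵐ a ∂μ, κ a ≪ η a
  · have hac : μ ⊗ₘ κ ≪ μ ⊗ₘ η := Measure.AbsolutelyContinuous.compProd_right h
    have hd : (μ ⊗ₘ κ).rnDeriv (μ ⊗ₘ η) =ᵐ[μ ⊗ₘ η] fun p => κ.rnDeriv η p.1 p.2 := by
      rw [compProd_eq_withDensity μ κ η h]
      exact Measure.rnDeriv_withDensity _ hm
    rw [klDiv_eq_lintegral_klFun_of_ac hac]
    have : ∫⁻ p, ENNReal.ofReal (klFun ((μ ⊗ₘ κ).rnDeriv (μ ⊗ₘ η) p).toReal) ∂(μ ⊗ₘ η)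
        = ∫⁻ p, ENNReal.ofReal (klFun (κ.rnDeriv η p.1 p.2).toReal) ∂(μ ⊗ₘ η) := by
      refine lintegral_congr_ae ?_
      filter_upwards [hd] with p hp
      rw [hp]
    rw [this, Measure.lintegral_compProd (by fun_prop)]
    refine lintegral_congr_ae ?_
    filter_upwards [h] with a ha
    rw [klDiv_kernel_eq κ η ha]
  · rw [klDiv_of_not_ac (fun h' => h (Measure.AbsolutelyContinuous.kernel_of_compProd h'))]
    symm
    -- A finite integral would make the divergence finite, hence `κ a ≪ η a`, for almost every `a`.
    by_contra hne
    refine h ?_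
    filter_upwards [ae_lt_top (measurable_klDiv κ η) hne] with a ha
    exact (klDiv_ne_top_iff.1 ha.ne).1

/-- Changing the density of the reference measure by the density of an image of `J` does not
increase the divergence of `J`. -/
lemma klDiv_withDensity_comp_le (J Q : Measure α) [IsProbabilityMeasure J]
    [IsProbabilityMeasure Q] {p : α → β} (hp : Measurable p) {G : β → ℝ≥0∞} (hG : Measurable G)
    (h : J.map p = (Q.map p).withDensity G) :
    klDiv J (Q.withDensity (G ∘ p)) ≤ klDiv J Q := by
  by_cases htop : klDiv J Q = ∞
  · simp [htop]
  have hGp : Measurable (G ∘ p) := hG.comp hp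
  obtain ⟨hac, hint⟩ := klDiv_ne_top_iff.1 htop
  set M := Q.withDensity (G ∘ p) with hM
  have hMprob : IsProbabilityMeasure M := by
    constructor
    have := congrArg (fun m => m Set.univ) h
    simp only [withDensity_apply _ MeasurableSet.univ, Measure.restrict_univ,
      Measure.map_apply hp MeasurableSet.univ, Set.preimage_univ, measure_univ] at this
    rw [lintegral_map hG hp] at this
    rw [hM, withDensity_apply _ MeasurableSet.univ, Measure.restrict_univ]
    exact this.symm
  have : IsProbabilityMeasure (J.map p) := Measure.isProbabilityMeasure_map hp.aemeasurable
  have : IsProbabilityMeasure (Q.map p) := Measure.isProbabilityMeasure_map hp.aemeasurable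
  have hGpos : ∀ᵐ a ∂J, G (p a) ≠ 0 := by
    refine ae_of_ae_map hp.aemeasurable (p := fun b => G b ≠ 0) ?_
    rw [h, ae_withDensity_iff hG]
    exact Filter.Eventually.of_forall fun b hb => hb
  have hJM : J ≪ M := by
    refine Measure.AbsolutelyContinuous.mk fun s hs h0 => ?_
    rw [hM, withDensity_apply_eq_zero hGp] at h0
    have h1 := hac h0
    refine measure_mono_null (t := {a | ¬ G (p a) ≠ 0} ∪ ({x | (G ∘ p) x ≠ 0} ∩ s)) ?_
      (measure_union_null hGpos h1)
    intro a ha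
    by_cases h2 : G (p a) = 0
    · exact Or.inl (by simpa using h2)
    · exact Or.inr ⟨h2, ha⟩
  have hmap : klDiv (J.map p) (Q.map p) ≠ ∞ :=
    ne_top_of_le_ne_top htop (klDiv_map_le J Q hp)
  obtain ⟨hac', hint'⟩ := klDiv_ne_top_iff.1 hmap
  have hllr' : (fun b => Real.log (G b).toReal) =ᵐ[J.map p] llr (J.map p) (Q.map p) := by
    refine hac'.ae_le ?_
    have := Measure.rnDeriv_withDensity (Q.map p) hG
    rw [← h] at this
    filter_upwards [this] with b hb
    rw [llr, hb]
  have hGint : Integrable (fun a => Real.log (G (p a)).toReal) J :=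
    ((integrable_congr hllr').2 hint').comp_measurable hp
  -- This integral is the divergence of the image laws, nonnegative by Gibbs' inequality. It is the
  -- amount by which the divergence of `J` drops.
  have hGnonneg : 0 ≤ ∫ a, Real.log (G (p a)).toReal ∂J := by
    rw [← integral_map (f := fun b => Real.log (G b).toReal) hp.aemeasurable
      hG.ennreal_toReal.log.aestronglyMeasurable, integral_congr_ae hllr']
    have := integral_llr_add_sub_measure_univ_nonneg hac' hint'
    simpa using this
  have hGtop : ∀ᵐ a ∂Q, G (p a) < ∞ := by
    refine ae_lt_top hGp ?_
    have : ∫⁻ a, G (p a) ∂Q = M Set.univ := by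
      rw [hM, withDensity_apply _ MeasurableSet.univ, Measure.restrict_univ]
      rfl
    rw [this]
    simp
  -- Chain rule for densities: `dJ/dQ = dJ/dM · dM/dQ` with `dM/dQ = G ∘ p`.
  have hsum : llr J Q =ᵐ[J] fun a => llr J M a + Real.log (G (p a)).toReal := by
    have h1 := hac.ae_le (Measure.rnDeriv_mul_rnDeriv (κ := Q) hJM)
    have h2 := hac.ae_le (Measure.rnDeriv_withDensity Q hGp)
    filter_upwards [h1, h2, hGpos, hac.ae_le hGtop, Measure.rnDeriv_pos hJM,
      hJM.ae_le (Measure.rnDeriv_lt_top J M)] with a h1 h2 h3 h4 h5 h6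
    rw [llr, ← h1, Pi.mul_apply, h2, ENNReal.toReal_mul, Real.log_mul, llr]
    · rfl
    · exact (ENNReal.toReal_pos h5.ne' h6.ne).ne'
    · exact (ENNReal.toReal_pos h3 h4.ne).ne'
  have hJMint : Integrable (llr J M) J := by
    have := hint.sub hGint
    refine this.congr ?_
    filter_upwards [hsum] with a ha
    simp [ha]
  rw [klDiv_of_ac_of_integrable hJM hJMint, klDiv_of_ac_of_integrable hac hint]
  refine ENNReal.ofReal_le_ofReal ?_
  rw [integral_congr_ae hsum, integral_add hJMint hGint]
  simp only [probReal_univ]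
  linarith

lemma map_compProd_comap (μ : Measure α) [SFinite μ] {g : α → γ} (hg : Measurable g)
    (κ : Kernel γ β) [IsSFiniteKernel κ] :
    (μ ⊗ₘ κ.comap g hg).map (Prod.map g id) = μ.map g ⊗ₘ κ := by
  have hpm : Measurable (Prod.map g id : α × β → γ × β) := hg.prodMap measurable_id
  ext s hs
  rw [Measure.map_apply hpm hs, Measure.compProd_apply (hpm hs), Measure.compProd_apply hs,
    lintegral_map (Kernel.measurable_kernel_prodMk_left hs) hg]
  rfl

/-- Among the kernels that factor through `g`, the conditional distribution is the best
predictor. -/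
lemma klDiv_compProd_comap_le [MeasurableSpace.CountableOrCountablyGenerated γ β]
    (μ : Measure α) [IsProbabilityMeasure μ] {g : α → γ} (hg : Measurable g)
    (J : Measure (α × β)) [IsProbabilityMeasure J]
    (m κ : Kernel γ β) [IsMarkovKernel m] [IsMarkovKernel κ]
    (hJ : J.map (Prod.map g id) = μ.map g ⊗ₘ m) :
    klDiv J (μ ⊗ₘ m.comap g hg) ≤ klDiv J (μ ⊗ₘ κ.comap g hg) := by
  have hpm : Measurable (Prod.map g id : α × β → γ × β) := hg.prodMap measurable_id
  have hprob : IsProbabilityMeasure (μ.map g) := Measure.isProbabilityMeasure_map hg.aemeasurable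
  by_cases htop : klDiv J (μ ⊗ₘ κ.comap g hg) = ∞
  · simp [htop]
  -- Finite divergence survives the map `g × id`, which yields `m ≪ κ` almost everywhere. Replacing
  -- `κ` by `m` is then a reweighting by `dm/dκ`, a function of the image point.
  have hac := (klDiv_ne_top_iff.1
    (ne_top_of_le_ne_top htop (klDiv_map_le J (μ ⊗ₘ κ.comap g hg) hpm))).1
  rw [hJ, map_compProd_comap] at hac
  have hae := hac.kernel_of_compProd
  have h1 := compProd_eq_withDensity (μ.map g) m κ hae
  have hG := Kernel.measurable_rnDeriv m κ
  have h2 : μ ⊗ₘ m.comap g hg =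
      (μ ⊗ₘ κ.comap g hg).withDensity ((fun p => m.rnDeriv κ p.1 p.2) ∘ Prod.map g id) := by
    have hae' := ae_of_ae_map hg.aemeasurable hae
    ext s hs
    rw [Measure.compProd_apply hs, withDensity_apply _ hs, ← lintegral_indicator hs,
      Measure.lintegral_compProd ((hG.comp hpm).indicator hs)]
    refine lintegral_congr_ae ?_
    filter_upwards [hae'] with a ha
    rw [Kernel.comap_apply, ← Kernel.setLIntegral_rnDeriv ha (measurable_prodMk_left hs),
      ← lintegral_indicator (measurable_prodMk_left hs)]
    rfl
  rw [h2]
  exact klDiv_withDensity_comp_le J _ hpm hG (by rw [hJ, map_compProd_comap, h1])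

end Divergence

/-! ### Laws of sequentially generated data -/

section DataKernel

variable {α γ 𝒳 𝒴 : Type*} [MeasurableSpace α] [MeasurableSpace γ]
  [MeasurableSpace 𝒳] [MeasurableSpace 𝒴]

/-- Appending an element to a finite sequence, as a measurable equivalence. -/
def snocEquiv (β : Type*) [MeasurableSpace β] (t : ℕ) :
    (Fin t → β) × β ≃ᵐ (Fin (t + 1) → β) :=
  MeasurableEquiv.prodComm.trans
    (MeasurableEquiv.piFinSuccAbove (fun _ : Fin (t + 1) => β) (Fin.last t)).symm

lemma snocEquiv_apply_seq {β : Type*} [MeasurableSpace β] (t : ℕ) (f : ℕ → β) :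
    snocEquiv β t ((fun i : Fin t => f i), f t) = fun i : Fin (t + 1) => f i := by
  change Fin.insertNth (α := fun _ => β) (Fin.last t) (f t) (fun i : Fin t => f i) = _
  rw [Fin.insertNth_last']
  ext i
  refine Fin.lastCases ?_ (fun j => ?_) i <;> simp

/-- Appending a pair, given as two components, to a finite sequence of pairs. -/
def appendPair (𝒳 𝒴 : Type*) [MeasurableSpace 𝒳] [MeasurableSpace 𝒴] (t : ℕ) :
    ((Fin t → 𝒳 × 𝒴) × 𝒳) × 𝒴 ≃ᵐ (Fin (t + 1) → 𝒳 × 𝒴) :=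
  MeasurableEquiv.prodAssoc.trans (snocEquiv (𝒳 × 𝒴) t)

/-- The version of `appendPair` with a parameter. -/
def appendPairParam (α 𝒳 𝒴 : Type*) [MeasurableSpace α] [MeasurableSpace 𝒳] [MeasurableSpace 𝒴]
    (t : ℕ) : ((α × (Fin t → 𝒳 × 𝒴)) × 𝒳) × 𝒴 ≃ᵐ α × (Fin (t + 1) → 𝒳 × 𝒴) :=
  MeasurableEquiv.prodAssoc.trans (MeasurableEquiv.prodAssoc.trans
    ((MeasurableEquiv.refl α).prodCongr (snocEquiv (𝒳 × 𝒴) t)))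

/-- The distribution of the first `t` data pairs when the inputs are iid with law `ν` and the
output at time `s` is drawn from `η s`, given the parameter, the earlier pairs and the input. -/
noncomputable def dataKernel (ν : Measure 𝒳) (η : ∀ t, Kernel ((α × (Fin t → 𝒳 × 𝒴)) × 𝒳) 𝒴) :
    ∀ t, Kernel α (Fin t → 𝒳 × 𝒴)
  | 0 => Kernel.const α (Measure.dirac (fun i => i.elim0))
  | t + 1 => (dataKernel ν η t ⊗ₖ (Kernel.const _ ν ⊗ₖ η t)).map (snocEquiv (𝒳 × 𝒴) t)

variable (ν : Measure 𝒳) [IsProbabilityMeasure ν]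
  (η : ∀ t, Kernel ((α × (Fin t → 𝒳 × 𝒴)) × 𝒳) 𝒴)

lemma compProd_dataKernel_succ (μ : Measure α) [SFinite μ] (t : ℕ) :
    μ ⊗ₘ dataKernel ν η (t + 1) =
      (((μ ⊗ₘ dataKernel ν η t).prod ν) ⊗ₘ η t).map (appendPairParam α 𝒳 𝒴 t) := by
  rw [dataKernel, Measure.compProd_map (snocEquiv (𝒳 × 𝒴) t).measurable,
    ← Measure.compProd_assoc', ← Measure.compProd_assoc', Measure.compProd_const,
    Measure.map_map (by fun_prop) (by fun_prop), Measure.map_map (by fun_prop) (by fun_prop)]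
  rfl

variable [∀ t, IsMarkovKernel (η t)]

instance dataKernel.instIsMarkovKernel (t : ℕ) : IsMarkovKernel (dataKernel ν η t) := by
  induction t with
  | zero => exact inferInstanceAs (IsMarkovKernel (Kernel.const _ _))
  | succ t ih => exact Kernel.IsMarkovKernel.map _ (snocEquiv (𝒳 × 𝒴) t).measurable

lemma dataKernel_succ_apply (t : ℕ) (a : α) :
    dataKernel ν η (t + 1) a = (((dataKernel ν η t a).prod ν) ⊗ₘ
      (η t).comap (fun q : (Fin t → 𝒳 × 𝒴) × 𝒳 => ((a, q.1), q.2)) (by fun_prop)).map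
        (appendPair 𝒳 𝒴 t) := by
  rw [dataKernel, Kernel.map_apply _ (snocEquiv (𝒳 × 𝒴) t).measurable, appendPair,
    MeasurableEquiv.coe_trans, ← Measure.map_map (MeasurableEquiv.measurable _)
      (MeasurableEquiv.measurable _), ← Measure.compProd_const, Measure.compProd_assoc',
    Kernel.compProd_apply_eq_compProd_sectR]
  congr 2
  ext h s hs
  rw [Kernel.sectR_apply, Kernel.compProd_apply hs, Kernel.compProd_apply hs]
  rfl

/-- Used to add or drop parameters on which the output kernels do not depend, so that two data laws
can be compared over a common parameter space. -/
lemma dataKernel_comap (f : γ → α) (hf : Measurable f) (t : ℕ) :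
    dataKernel ν (fun t => (η t).comap
      (fun q : (γ × (Fin t → 𝒳 × 𝒴)) × 𝒳 => ((f q.1.1, q.1.2), q.2)) (by fun_prop)) t =
      (dataKernel ν η t).comap f hf := by
  induction t with
  | zero => rfl
  | succ t ih =>
    ext1 c
    rw [Kernel.comap_apply, dataKernel_succ_apply, dataKernel_succ_apply, ih]
    rfl

variable [MeasurableSpace.CountablyGenerated 𝒴]

/-- Chain rule for the divergence of data sequences. -/
lemma klDiv_compProd_dataKernel (η' : ∀ t, Kernel ((α × (Fin t → 𝒳 × 𝒴)) × 𝒳) 𝒴)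
    [∀ t, IsMarkovKernel (η' t)] (μ : Measure α) [IsProbabilityMeasure μ] (T : ℕ) :
    klDiv (μ ⊗ₘ dataKernel ν η T) (μ ⊗ₘ dataKernel ν η' T) =
      ∑ t ∈ Finset.range T,
        ∫⁻ q, klDiv (η t q) (η' t q) ∂((μ ⊗ₘ dataKernel ν η t).prod ν) := by
  induction T with
  | zero => simp [dataKernel]
  | succ T ih =>
    -- The last round adds the output term only: both inputs are drawn from the same `ν`, so the new
    -- input contributes no divergence.
    rw [Finset.sum_range_succ, ← ih, compProd_dataKernel_succ, compProd_dataKernel_succ,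
      klDiv_map_measurableEquiv, klDiv_compProd_eq_add, klDiv_compProd_right,
      ← Measure.compProd_const, ← Measure.compProd_const, klDiv_compProd_left]

end DataKernel

/-! ### Conditional independence and randomization -/

section CondIndep

lemma setIntegral_kernel_toReal {Ω γ δ : Type*} [MeasurableSpace Ω] [MeasurableSpace γ]
    [MeasurableSpace δ] {Q : Measure Ω} (K : Kernel γ δ) [IsMarkovKernel K] {C : Ω → γ}
    (hC : Measurable C) {t : Set δ} (ht : MeasurableSet t) {s : Set Ω} :
    ∫ ω in s, (K (C ω) t).toReal ∂Q = (∫⁻ ω in s, K (C ω) t ∂Q).toReal :=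
  integral_toReal ((K.measurable_coe ht).comp hC).aemeasurable
    (Filter.Eventually.of_forall fun _ => measure_lt_top _ _)

/-- Translates a disintegration of a joint law into conditional expectations, with no regularity of
the spaces. -/
lemma condExp_preimage_eq_of_law {Ω γ δ : Type*} [MeasurableSpace Ω] [mγ : MeasurableSpace γ]
    [MeasurableSpace δ] {Q : Measure Ω} [IsProbabilityMeasure Q] {C : Ω → γ} {B : Ω → δ}
    (hC : Measurable C) (hB : Measurable B) (K : Kernel γ δ) [IsMarkovKernel K]
    (h : Q.map (fun ω => (C ω, B ω)) = Q.map C ⊗ₘ K) {t : Set δ} (ht : MeasurableSet t) :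
    Q⟦B ⁻¹' t | mγ.comap C⟧ =ᵐ[Q] fun ω => (K (C ω)).real t := by
  have hKm : Measurable fun c => (K c).real t := (K.measurable_coe ht).ennreal_toReal
  have hint : Integrable (fun ω => (K (C ω)).real t) Q :=
    Integrable.of_bound (hKm.comp hC).aestronglyMeasurable 1
      (Filter.Eventually.of_forall fun ω => by
        rw [Real.norm_of_nonneg measureReal_nonneg]; exact measureReal_le_one)
  symm
  refine ae_eq_condExp_of_forall_setIntegral_eq hC.comap_le
    ((integrable_const 1).indicator (hB ht)) (fun _ _ _ => hint.integrableOn) ?_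
    ((hKm.comp (comap_measurable C)).stronglyMeasurable.aestronglyMeasurable)
  rintro _ ⟨c, hc, rfl⟩ -
  rw [setIntegral_indicator (hB ht)]
  simp only [setIntegral_const, smul_eq_mul, mul_one, measureReal_def]
  rw [setIntegral_kernel_toReal K hC ht]
  congr 1
  rw [← setLIntegral_map hc (K.measurable_coe ht) hC, ← Measure.compProd_apply_prod hc ht, ← h,
    Measure.map_apply (hC.prodMk hB) (hc.prod ht)]
  rfl

/-- If `A` and `B` are conditionally independent given `C`, then the distribution of `φ B`
conditioned on `C` is also its distribution conditioned on `(C, A)`. -/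
lemma CondIndepGiven.map_eq_compProd {Ω α β γ δ : Type*} [MeasurableSpace Ω] [MeasurableSpace α]
    [MeasurableSpace β] [mγ : MeasurableSpace γ] [MeasurableSpace δ] {Q : Measure Ω}
    [IsProbabilityMeasure Q] {A : Ω → α} {B : Ω → β} {C : Ω → γ}
    (hAB : CondIndepGiven Q A B C) (hA : Measurable A) (hB : Measurable B) (hC : Measurable C)
    {φ : β → δ} (hφ : Measurable φ) (K : Kernel γ δ) [IsMarkovKernel K]
    (h : Q.map (fun ω => (C ω, φ (B ω))) = Q.map C ⊗ₘ K) :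
    Q.map (fun ω => ((C ω, A ω), φ (B ω))) =
      Q.map (fun ω => (C ω, A ω)) ⊗ₘ K.comap Prod.fst measurable_fst := by
  have hCA : Measurable fun ω => (C ω, A ω) := hC.prodMk hA
  have hprob : IsProbabilityMeasure (Q.map fun ω => (C ω, A ω)) :=
    Measure.isProbabilityMeasure_map hCA.aemeasurable
  have hprob' : IsProbabilityMeasure (Q.map fun ω => ((C ω, A ω), φ (B ω))) :=
    Measure.isProbabilityMeasure_map (by fun_prop)
  rw [Measure.ext_prod₃_iff']
  intro c a d hc ha hd
  rw [Measure.compProd_apply_prod (hc.prod ha) hd,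
    setLIntegral_map (hc.prod ha) (Kernel.measurable_coe _ hd) hCA,
    Measure.map_apply (by fun_prop) ((hc.prod ha).prod hd)]
  have hKm : Measurable fun c => (K c).real d := (K.measurable_coe hd).ennreal_toReal
  have hKC : Measurable[mγ.comap C] fun ω => (K (C ω)).real d := hKm.comp (comap_measurable C)
  have hb : MeasurableSet (φ ⁻¹' d) := hφ hd
  have h1 := condExp_preimage_eq_of_law hC (hφ.comp hB) K h hd
  have h2 := hAB a (φ ⁻¹' d) ha hb
  have hAint : Integrable ((A ⁻¹' a).indicator fun _ => (1 : ℝ)) Q :=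
    (integrable_const 1).indicator (hA ha)
  have hprod : Integrable
      (((A ⁻¹' a).indicator fun _ => (1 : ℝ)) * fun ω => (K (C ω)).real d) Q :=
    hAint.mul_bdd (c := 1) (hKm.comp hC).aestronglyMeasurable
      (Filter.Eventually.of_forall fun ω => by
        rw [Real.norm_of_nonneg measureReal_nonneg]; exact measureReal_le_one)
  have h3 := condExp_mul_of_stronglyMeasurable_right (m := mγ.comap C) hKC.stronglyMeasurable
    hprod hAint
  -- Conditional independence factors the left side; the factor `K(C)(d)` is `C`-measurable and so
  -- moves back inside the conditional expectation of the indicator of `A`.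
  have h4 : Q[(A ⁻¹' a ∩ B ⁻¹' (φ ⁻¹' d)).indicator (fun _ => (1 : ℝ)) | mγ.comap C] =ᵐ[Q]
      Q[((A ⁻¹' a).indicator fun _ => (1 : ℝ)) * fun ω => (K (C ω)).real d | mγ.comap C] := by
    refine h2.trans (Filter.EventuallyEq.trans ?_ h3.symm)
    filter_upwards [h1] with ω hω
    rw [Pi.mul_apply, Pi.mul_apply, ← hω]
    rfl
  have h5 : MeasurableSet[mγ.comap C] (C ⁻¹' c) := ⟨c, hc, rfl⟩
  have h6 := setIntegral_condExp hC.comap_le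
    ((integrable_const (1 : ℝ)).indicator ((hA ha).inter (hB hb)) (μ := Q)) h5
  rw [setIntegral_congr_ae (hC hc) (h4.mono fun ω hω _ => hω),
    setIntegral_condExp hC.comap_le hprod h5] at h6
  have h7 : (((A ⁻¹' a).indicator fun _ => (1 : ℝ)) * fun ω => (K (C ω)).real d) =
      (A ⁻¹' a).indicator fun ω => (K (C ω)).real d := by
    ext ω
    by_cases hω : ω ∈ A ⁻¹' a <;> simp [hω]
  rw [h7, setIntegral_indicator (hA ha), setIntegral_indicator ((hA ha).inter (hB hb))] at h6
  simp only [setIntegral_const, smul_eq_mul, mul_one, measureReal_def] at h6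
  rw [setIntegral_kernel_toReal K hC hd] at h6
  rw [ENNReal.toReal_eq_toReal_iff' ?_ (measure_ne_top _ _)] at h6
  · simp only [Kernel.comap_apply]
    rw [show (fun ω => (C ω, A ω)) ⁻¹' c ×ˢ a = C ⁻¹' c ∩ A ⁻¹' a from rfl]
    rw [h6, ← Set.inter_assoc]
    rfl
  · refine ne_top_of_le_ne_top (b := ∫⁻ _, 1 ∂Q) (by simp) ?_
    exact (setLIntegral_le_lintegral _ _).trans (lintegral_mono fun ω => prob_le_one)

variable {Ω γ δ : Type*} [MeasurableSpace Ω] [mγ : MeasurableSpace γ] [MeasurableSpace δ]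
  {P : Measure Ω} [IsProbabilityMeasure P]

/-- Fubini: for fixed `ω`, integrating out the uniform variable turns the event `f (C ω) u ∈ s` into
the factor `κ (C ω) s`. -/
lemma condExp_randomized_inter {C : Ω → γ} (hC : Measurable C) {f : γ → I → δ}
    (hf : Measurable (Function.uncurry f)) (κ : Kernel γ δ) [IsMarkovKernel κ]
    (hκ : ∀ c, Measure.map (f c) volume = κ c) {s : Set δ} (hs : MeasurableSet s)
    {b : Set Ω} (hb : MeasurableSet b) :
    (P.prod (volume : Measure I))⟦(fun ω => f (C ω.1) ω.2) ⁻¹' s ∩ Prod.fst ⁻¹' b |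
        mγ.comap (fun ω => C ω.1)⟧ =ᵐ[P.prod volume]
      (fun ω => (κ (C ω.1)).real s) *
        (P.prod (volume : Measure I))⟦Prod.fst ⁻¹' b | mγ.comap (fun ω => C ω.1)⟧ := by
  set Q : Measure (Ω × I) := P.prod volume with hQ
  set C' : Ω × I → γ := fun ω => C ω.1 with hC'def
  have hC' : Measurable C' := hC.comp measurable_fst
  have hZ : Measurable fun ω : Ω × I => f (C ω.1) ω.2 :=
    hf.comp (hC'.prodMk measurable_snd)
  have hb' : MeasurableSet (Prod.fst ⁻¹' b : Set (Ω × I)) := measurable_fst hb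
  have hκm : Measurable fun c => (κ c).real s := (κ.measurable_coe hs).ennreal_toReal
  have hκC : Measurable[mγ.comap C'] fun ω => (κ (C' ω)).real s :=
    hκm.comp (comap_measurable C')
  have hbint : Integrable ((Prod.fst ⁻¹' b : Set (Ω × I)).indicator fun _ => (1 : ℝ)) Q :=
    (integrable_const 1).indicator hb'
  have hprod : Integrable ((fun ω => (κ (C' ω)).real s) *
      ((Prod.fst ⁻¹' b : Set (Ω × I)).indicator fun _ => (1 : ℝ))) Q :=
    hbint.bdd_mul (c := 1) (hκm.comp hC').aestronglyMeasurable
      (Filter.Eventually.of_forall fun ω => by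
        rw [Real.norm_of_nonneg measureReal_nonneg]; exact measureReal_le_one)
  have h1 := condExp_mul_of_stronglyMeasurable_left (m := mγ.comap C') hκC.stronglyMeasurable
    hprod hbint
  refine Filter.EventuallyEq.trans ?_ h1
  symm
  refine ae_eq_condExp_of_forall_setIntegral_eq hC'.comap_le
    ((integrable_const 1).indicator ((hZ hs).inter hb'))
    (fun _ _ _ => integrable_condExp.integrableOn) ?_
    stronglyMeasurable_condExp.aestronglyMeasurable
  rintro _ ⟨c, hc, rfl⟩ -
  rw [setIntegral_condExp hC'.comap_le hprod ⟨c, hc, rfl⟩]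
  have h7 : ((fun ω => (κ (C' ω)).real s) *
      ((Prod.fst ⁻¹' b : Set (Ω × I)).indicator fun _ => (1 : ℝ))) =
      (Prod.fst ⁻¹' b : Set (Ω × I)).indicator fun ω => (κ (C' ω)).real s := by
    ext ω
    by_cases hω : ω ∈ (Prod.fst ⁻¹' b : Set (Ω × I)) <;> simp [hω]
  rw [h7, setIntegral_indicator hb', setIntegral_indicator ((hZ hs).inter hb')]
  simp only [setIntegral_const, smul_eq_mul, mul_one, measureReal_def]
  rw [setIntegral_kernel_toReal κ hC' hs]
  congr 1
  have h8 : MeasurableSet (C ⁻¹' c ∩ b) := (hC hc).inter hb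
  have h9 : C' ⁻¹' c ∩ Prod.fst ⁻¹' b = (C ⁻¹' c ∩ b) ×ˢ (Set.univ : Set I) := by
    ext ω; simp [hC'def]
  rw [h9, hQ, ← Measure.prod_restrict, Measure.restrict_univ,
    lintegral_prod (fun ω => κ (C' ω) s) ((κ.measurable_coe hs).comp hC').aemeasurable]
  simp only [hC'def, lintegral_const, measure_univ, mul_one]
  have h10 : (fun ω : Ω × I => C ω.1) ⁻¹' c ∩
      ((fun ω => f (C ω.1) ω.2) ⁻¹' s ∩ Prod.fst ⁻¹' b) =
      (fun ω => f (C ω.1) ω.2) ⁻¹' s ∩ ((C ⁻¹' c ∩ b) ×ˢ Set.univ) := by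
    ext ω; simp; tauto
  rw [h10, ← Measure.restrict_apply (hZ hs), ← Measure.prod_restrict, Measure.restrict_univ,
    Measure.prod_apply (hZ hs)]
  refine lintegral_congr fun ω => ?_
  rw [← hκ, Measure.map_apply hf.of_uncurry_left hs]
  rfl

/-- A random variable drawn from a kernel with parameter `C`, using independent randomness, is
conditionally independent given `C` of everything on the original space. -/
lemma condIndepGiven_randomized {β : Type*} [MeasurableSpace β] {C : Ω → γ} (hC : Measurable C)
    {B : Ω → β} (hB : Measurable B) {f : γ → I → δ}
    (hf : Measurable (Function.uncurry f)) (κ : Kernel γ δ) [IsMarkovKernel κ]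
    (hκ : ∀ c, Measure.map (f c) volume = κ c) :
    CondIndepGiven (P.prod (volume : Measure I)) (fun ω => f (C ω.1) ω.2) (fun ω => B ω.1)
      (fun ω => C ω.1) := by
  intro s t hs ht
  have h1 := condExp_randomized_inter (P := P) hC hf κ hκ hs (hB ht)
  -- The trivial event identifies the factor `κ(C)(s)` as the conditional probability of `s`.
  have h2 := condExp_randomized_inter (P := P) hC hf κ hκ hs MeasurableSet.univ
  rw [Set.preimage_univ, Set.inter_univ] at h2
  refine h1.trans ?_
  have hC' : Measurable fun ω : Ω × I => C ω.1 := hC.comp measurable_fst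
  have h3 : (P.prod (volume : Measure I))⟦Set.univ | mγ.comap (fun ω => C ω.1)⟧ = fun _ => 1 := by
    rw [Set.indicator_univ]
    exact condExp_const hC'.comap_le 1
  rw [h3] at h2
  filter_upwards [h2] with ω hω
  rw [Pi.mul_apply, Pi.mul_apply, hω]
  simp
  exact Or.inl rfl

lemma map_randomized {C : Ω → γ} (hC : Measurable C) {f : γ → I → δ}
    (hf : Measurable (Function.uncurry f)) (κ : Kernel γ δ) [IsMarkovKernel κ]
    (hκ : ∀ c, Measure.map (f c) volume = κ c) :
    (P.prod (volume : Measure I)).map (fun ω => (C ω.1, f (C ω.1) ω.2)) = P.map C ⊗ₘ κ := by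
  have hm : Measurable fun ω : Ω × I => (C ω.1, f (C ω.1) ω.2) :=
    (hC.comp measurable_fst).prodMk (hf.comp ((hC.comp measurable_fst).prodMk measurable_snd))
  ext s hs
  rw [Measure.map_apply hm hs, Measure.prod_apply (hm hs), Measure.compProd_apply hs,
    lintegral_map (Kernel.measurable_kernel_prodMk_left hs) hC]
  refine lintegral_congr fun ω => ?_
  rw [← hκ, Measure.map_apply hf.of_uncurry_left (measurable_prodMk_left hs)]
  rfl

end CondIndep

/-! ### Iid models, agent models and the Bayesian agent -/

section Steps

/-- The output kernels of a data sequence that is iid given the parameter. -/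
noncomputable def iidStep {α 𝒳 𝒴 : Type*} [MeasurableSpace α] [MeasurableSpace 𝒳]
    [MeasurableSpace 𝒴] (κ : Kernel (α × 𝒳) 𝒴) (t : ℕ) :
    Kernel ((α × (Fin t → 𝒳 × 𝒴)) × 𝒳) 𝒴 :=
  κ.comap (fun q => (q.1.1, q.2)) (by fun_prop)

instance iidStep.instIsMarkovKernel {α 𝒳 𝒴 : Type*} [MeasurableSpace α] [MeasurableSpace 𝒳]
    [MeasurableSpace 𝒴] (κ : Kernel (α × 𝒳) 𝒴) [IsMarkovKernel κ] (t : ℕ) :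
    IsMarkovKernel (iidStep κ t) := inferInstanceAs (IsMarkovKernel (κ.comap _ _))

/-- The output kernels of a data sequence whose outputs are drawn from the predictions of an
agent. -/
noncomputable def agentStep (α : Type*) [MeasurableSpace α] {𝒳 𝒴 : Type u} [MeasurableSpace 𝒳]
    [MeasurableSpace 𝒴] (π : Agent 𝒳 𝒴) (t : ℕ) :
    Kernel ((α × (Fin t → 𝒳 × 𝒴)) × 𝒳) 𝒴 :=
  (π.predict t).comap (fun q => (q.1.2, q.2)) (by fun_prop)

instance agentStep.instIsMarkovKernel (α : Type*) [MeasurableSpace α] {𝒳 𝒴 : Type u}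
    [MeasurableSpace 𝒳] [MeasurableSpace 𝒴] (π : Agent 𝒳 𝒴) (t : ℕ) :
    IsMarkovKernel (agentStep α π t) :=
  have := π.predict_markov t
  inferInstanceAs (IsMarkovKernel ((π.predict t).comap _ _))

/-- An agent that predicts with the conditional distributions of a mixture of data sequences. -/
lemma exists_agent_dataKernel_eq {W : Type*} [MeasurableSpace W] {𝒳 𝒴 : Type u}
    [MeasurableSpace 𝒳] [MeasurableSpace 𝒴] [StandardBorelSpace 𝒴] [Nonempty 𝒴]
    (ν : Measure 𝒳) [IsProbabilityMeasure ν] (ρ : Measure W) [IsProbabilityMeasure ρ]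
    (η : ∀ t, Kernel ((W × (Fin t → 𝒳 × 𝒴)) × 𝒳) 𝒴) [∀ t, IsMarkovKernel (η t)] :
    ∃ π : Agent 𝒳 𝒴, ∀ (α : Type u) [MeasurableSpace α] (t : ℕ) (a : α),
      dataKernel ν (agentStep α π) t a = (ρ ⊗ₘ dataKernel ν η t).snd := by
  let d (t : ℕ) : ((W × (Fin t → 𝒳 × 𝒴)) × 𝒳) × 𝒴 → ((Fin t → 𝒳 × 𝒴) × 𝒳) × 𝒴 :=
    fun q => ((q.1.1.2, q.1.2), q.2)
  have hd (t : ℕ) : Measurable (d t) := by fun_prop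
  -- The law of (history, next output) in the mixture. The agent predicts with its conditional
  -- kernel, so by induction it regenerates the mixture's data law.
  let N (t : ℕ) : Measure (((Fin t → 𝒳 × 𝒴) × 𝒳) × 𝒴) :=
    (((ρ ⊗ₘ dataKernel ν η t).prod ν) ⊗ₘ η t).map (d t)
  have hN (t : ℕ) : IsProbabilityMeasure (N t) :=
    Measure.isProbabilityMeasure_map (hd t).aemeasurable
  have hfst (t : ℕ) : (N t).fst = (ρ ⊗ₘ dataKernel ν η t).snd.prod ν := by
    have h1 : (N t).fst = ((((ρ ⊗ₘ dataKernel ν η t).prod ν) ⊗ₘ η t).fst).map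
        (Prod.map Prod.snd id) := by
      rw [Measure.fst, Measure.fst, Measure.map_map measurable_fst (hd t),
        Measure.map_map (by fun_prop) measurable_fst]
      rfl
    rw [h1, Measure.fst_compProd, ← Measure.map_prod_map _ _ measurable_snd measurable_id,
      Measure.map_id]
    rfl
  have hsucc (t : ℕ) : (ρ ⊗ₘ dataKernel ν η (t + 1)).snd = (N t).map (appendPair 𝒳 𝒴 t) := by
    rw [compProd_dataKernel_succ, Measure.snd, Measure.map_map measurable_snd (by fun_prop),
      Measure.map_map (by fun_prop) (hd t)]
    rfl
  refine ⟨⟨fun t => (N t).condKernel, fun t => inferInstance⟩, fun α _ t a => ?_⟩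
  induction t with
  | zero =>
    have h0 (m : Measure (Fin 0 → 𝒳 × 𝒴)) [IsProbabilityMeasure m] :
        m = Measure.dirac (fun i => i.elim0) := by
      ext s hs
      by_cases h : (fun i => i.elim0) ∈ s
      · have : s = Set.univ := Set.eq_univ_of_forall fun x => by
          convert h
        simp [this]
      · have : s = ∅ := Set.eq_empty_of_forall_notMem fun x hx => h (by convert hx)
        simp [this]
    rw [h0 (ρ ⊗ₘ dataKernel ν η 0).snd]
    rfl
  | succ t ih =>
    rw [dataKernel_succ_apply, ih, hsucc, ← hfst]
    conv_rhs => rw [← (N t).disintegrate (N t).condKernel]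
    rfl

end Steps

/-! ### Joint laws of the process; regret as a divergence -/

namespace DataProcess

variable {Ω : Type v} [MeasurableSpace Ω] {P : Measure Ω}
  {Θ 𝒳 𝒴 : Type u} [MeasurableSpace Θ] [MeasurableSpace 𝒳] [MeasurableSpace 𝒴]

/-- The first `t` data pairs. -/
def pairs (D : DataProcess P Θ 𝒳 𝒴) (t : ℕ) (ω : Ω) : Fin t → 𝒳 × 𝒴 :=
  fun i => (D.X i ω, D.Y (i + 1) ω)

variable (D : DataProcess P Θ 𝒳 𝒴)

instance instIsMarkovKernelEnv : IsMarkovKernel D.env := D.env_markov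

lemma measurable_pairs (t : ℕ) : Measurable (D.pairs t) :=
  measurable_pi_lambda _ fun i => (D.measurable_X i).prodMk (D.measurable_Y (i + 1))

lemma measurable_data : Measurable D.data :=
  measurable_pi_lambda _ fun i => (D.measurable_X i).prodMk (D.measurable_Y (i + 1))

lemma map_extended {β : Type*} [MeasurableSpace β] {f : Ω → β} (hf : Measurable f) :
    (extended P).map (fun ω => f ω.1) = P.map f := by
  have h := Measure.map_map (μ := extended P) hf measurable_fst
  rw [← Measure.fst, Measure.fst_prod] at h
  exact h.symm

lemma map_E_extended (D : DataProcess P Θ 𝒳 𝒴) :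
    (extended P).map (fun ω => D.E ω.1) = P.map D.E := map_extended D.measurable_E

lemma IsProxy.measurable_E_Z {D : DataProcess P Θ 𝒳 𝒴} {W : Type*} [MeasurableSpace W]
    {Z : Ω × I → W} (hZ : D.IsProxy Z) :
    Measurable fun ω : Ω × I => (D.E ω.1, Z ω) :=
  (D.measurable_E.comp measurable_fst).prodMk hZ.measurable

variable [IsProbabilityMeasure P]

instance instIsProbabilityMeasureMapE : IsProbabilityMeasure (P.map D.E) :=
  Measure.isProbabilityMeasure_map D.measurable_E.aemeasurable

instance instIsProbabilityMeasureMapX (t : ℕ) : IsProbabilityMeasure (P.map (D.X t)) :=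
  Measure.isProbabilityMeasure_map (D.measurable_X t).aemeasurable

lemma map_E_pairs_X (t : ℕ) :
    P.map (fun ω => ((D.E ω, D.pairs t ω), D.X t ω)) =
      (P.map (fun ω => (D.E ω, D.pairs t ω))).prod (P.map (D.X 0)) := by
  rw [← (D.ident_X t).map_eq]
  exact (indepFun_iff_map_prod_eq_prod_map_map
    (D.measurable_E.prodMk (D.measurable_pairs t)).aemeasurable
    (D.measurable_X t).aemeasurable).1 (D.indep_X_past t).symm

lemma map_E_pairs_X_Y (t : ℕ) :
    P.map (fun ω => (((D.E ω, D.pairs t ω), D.X t ω), D.Y (t + 1) ω)) =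
      ((P.map (fun ω => (D.E ω, D.pairs t ω))).prod (P.map (D.X 0))) ⊗ₘ iidStep D.env t := by
  rw [← map_E_pairs_X]
  exact ((D.condDistrib_Y t).measurableEquiv_comp_right MeasurableEquiv.prodAssoc.symm).map_eq

lemma map_E_pairs (t : ℕ) :
    P.map (fun ω => (D.E ω, D.pairs t ω)) =
      P.map D.E ⊗ₘ dataKernel (P.map (D.X 0)) (iidStep D.env) t := by
  induction t with
  | zero =>
    rw [dataKernel, Measure.compProd_const, Measure.prod_dirac,
      Measure.map_map (by fun_prop) D.measurable_E]
    congr 1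
    ext ω : 1
    exact Prod.ext rfl (Subsingleton.elim _ _)
  | succ t ih =>
    have h1 : P.map (fun ω => (D.E ω, D.pairs (t + 1) ω)) =
        (P.map (fun ω => (((D.E ω, D.pairs t ω), D.X t ω), D.Y (t + 1) ω))).map
          (appendPairParam Θ 𝒳 𝒴 t) := by
      rw [Measure.map_map (MeasurableEquiv.measurable _)
        (((D.measurable_E.prodMk (D.measurable_pairs t)).prodMk (D.measurable_X t)).prodMk
          (D.measurable_Y (t + 1)))]
      congr 1
      ext ω : 1
      exact Prod.ext rfl (snocEquiv_apply_seq t (D.data ω)).symm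
    rw [h1, map_E_pairs_X_Y, ih, compProd_dataKernel_succ]

/-- The case `t = 0` of `map_E_pairs_X_Y`, with the empty history removed. -/
lemma map_E_X_Y :
    P.map (fun ω => (D.E ω, (D.X 0 ω, D.Y 1 ω))) =
      P.map D.E ⊗ₘ (Kernel.const Θ (P.map (D.X 0)) ⊗ₖ D.env) := by
  have h := D.map_E_pairs_X_Y 0
  have hmE := D.measurable_E
  have hmp := D.measurable_pairs 0
  have hmX := D.measurable_X 0
  have hmY := D.measurable_Y 1
  have hg : Measurable (Prod.map Prod.fst id : (Θ × (Fin 0 → 𝒳 × 𝒴)) × 𝒳 → Θ × 𝒳) := by fun_prop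
  have h1 := (congrArg (Measure.map (Prod.map (Prod.map Prod.fst id) id)) h).trans
    (map_compProd_comap _ hg D.env)
  rw [Measure.map_map (by fun_prop) (by fun_prop),
    ← Measure.map_prod_map _ _ measurable_fst measurable_id,
    Measure.map_map (by fun_prop) (by fun_prop), Measure.map_id] at h1
  rw [← Measure.compProd_assoc', Measure.compProd_const]
  refine Eq.trans ?_ (congrArg (Measure.map MeasurableEquiv.prodAssoc) h1)
  rw [Measure.map_map (by fun_prop) (by fun_prop)]
  rfl

/-- The expected cumulative error of an agent is the divergence of the law of the data from the
law that the predictions of the agent would produce. -/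
lemma agentRegret_eq [StandardBorelSpace 𝒴] (π : Agent 𝒳 𝒴) (T : ℕ) :
    D.agentRegret π T =
      klDiv (P.map D.E ⊗ₘ dataKernel (P.map (D.X 0)) (iidStep D.env) T)
        (P.map D.E ⊗ₘ dataKernel (P.map (D.X 0)) (agentStep Θ π) T) := by
  have hm (t : ℕ) := measurable_klDiv (iidStep D.env t) (agentStep Θ π t)
  have hm' (t : ℕ) : Measurable fun ω => ((D.E ω, D.pairs t ω), D.X t ω) :=
    (D.measurable_E.prodMk (D.measurable_pairs t)).prodMk (D.measurable_X t)
  rw [klDiv_compProd_dataKernel, agentRegret, lintegral_finsetSum]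
  · refine Finset.sum_congr rfl fun t _ => ?_
    rw [← map_E_pairs, ← map_E_pairs_X, lintegral_map (hm t) (hm' t)]
    rfl
  · exact fun t _ => (hm t).comp (hm' t)

/-! ### Joint laws with a proxy -/

section Proxy

variable {D} {W : Type*} [MeasurableSpace W] {Z : Ω × I → W}

/-- All that the later estimates use of a proxy's conditional independence: given `E`, knowing `Z`
does not alter the law of the data. -/
lemma IsProxy.map_eq_compProd (hZ : D.IsProxy Z) {δ : Type*} [MeasurableSpace δ]
    {φ : (ℕ → 𝒳 × 𝒴) → δ} (hφ : Measurable φ) (K : Kernel Θ δ) [IsMarkovKernel K]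
    (h : P.map (fun ω => (D.E ω, φ (D.data ω))) = P.map D.E ⊗ₘ K) :
    (extended P).map (fun ω => ((D.E ω.1, Z ω), φ (D.data ω.1))) =
      (extended P).map (fun ω => (D.E ω.1, Z ω)) ⊗ₘ K.comap Prod.fst measurable_fst := by
  refine hZ.condIndep.map_eq_compProd hZ.measurable (D.measurable_data.comp measurable_fst)
    (D.measurable_E.comp measurable_fst) hφ K ?_
  rw [map_extended D.measurable_E, ← h]
  exact map_extended (D.measurable_E.prodMk (hφ.comp D.measurable_data))

lemma IsProxy.map_E_Z_X_Y (hZ : D.IsProxy Z) :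
    (extended P).map (fun ω => (((D.E ω.1, Z ω), D.X 0 ω.1), D.Y 1 ω.1)) =
      (((extended P).map (fun ω => (D.E ω.1, Z ω))).prod (P.map (D.X 0))) ⊗ₘ
        D.env.comap (fun q : (Θ × W) × 𝒳 => (q.1.1, q.2)) (by fun_prop) := by
  have h := hZ.map_eq_compProd (φ := fun f => f 0) (by fun_prop)
    (Kernel.const Θ (P.map (D.X 0)) ⊗ₖ D.env) D.map_E_X_Y
  have h1 : (Kernel.const Θ (P.map (D.X 0)) ⊗ₖ D.env).comap
      (Prod.fst : Θ × W → Θ) measurable_fst = Kernel.const (Θ × W) (P.map (D.X 0)) ⊗ₖ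
        D.env.comap (fun q : (Θ × W) × 𝒳 => (q.1.1, q.2)) (by fun_prop) := by
    ext q s hs
    rw [Kernel.comap_apply, Kernel.compProd_apply hs, Kernel.compProd_apply hs]
    rfl
  rw [h1, ← Measure.compProd_assoc', Measure.compProd_const] at h
  have hm1 := hZ.measurable_E_Z
  have hm2 : Measurable fun ω : Ω × I => D.X 0 ω.1 := (D.measurable_X 0).comp measurable_fst
  have hm3 : Measurable fun ω : Ω × I => D.Y 1 ω.1 := (D.measurable_Y 1).comp measurable_fst
  refine MeasurableEquiv.prodAssoc.map_measurableEquiv_injective (Eq.trans ?_ h)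
  rw [Measure.map_map (by fun_prop) ((hm1.prodMk hm2).prodMk hm3)]
  rfl

lemma IsProxy.map_E_Z_X (hZ : D.IsProxy Z) :
    (extended P).map (fun ω => ((D.E ω.1, Z ω), D.X 0 ω.1)) =
      ((extended P).map (fun ω => (D.E ω.1, Z ω))).prod (P.map (D.X 0)) := by
  have h := congrArg Measure.fst hZ.map_E_Z_X_Y
  have hm3 : Measurable fun ω : Ω × I => D.Y 1 ω.1 := (D.measurable_Y 1).comp measurable_fst
  rw [Measure.fst_compProd, Measure.fst_map_prodMk hm3] at h
  exact h

lemma IsProxy.lintegral_klDiv_eq [StandardBorelSpace 𝒴] (hZ : D.IsProxy Z)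
    (κ : Kernel (W × 𝒳) 𝒴) [IsMarkovKernel κ] :
    ∫⁻ ω, klDiv (D.target 0 ω.1) (κ (Z ω, D.X 0 ω.1)) ∂(extended P) =
      ∫⁻ q, klDiv (D.env (q.1.1, q.2)) (κ (q.1.2, q.2))
        ∂(((extended P).map (fun ω => (D.E ω.1, Z ω))).prod (P.map (D.X 0))) := by
  rw [← hZ.map_E_Z_X, lintegral_map]
  · rfl
  · exact measurable_klDiv
      (D.env.comap (fun q : (Θ × W) × 𝒳 => (q.1.1, q.2)) (by fun_prop))
      (κ.comap (fun q : (Θ × W) × 𝒳 => (q.1.2, q.2)) (by fun_prop))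
  · exact hZ.measurable_E_Z.prodMk ((D.measurable_X 0).comp measurable_fst)

end Proxy

end DataProcess

/-- Integrating out a variable on which the kernel depends but the first variable does not. -/
lemma map_prod_compProd_comap_snd {α β γ : Type*} [MeasurableSpace α] [MeasurableSpace β]
    [MeasurableSpace γ] (μ : Measure α) [IsProbabilityMeasure μ] (ρ : Measure β)
    [IsProbabilityMeasure ρ] (κ : Kernel β γ) [IsMarkovKernel κ] :
    ((μ.prod ρ) ⊗ₘ κ.comap Prod.snd measurable_snd).map (fun q => (q.1.1, q.2)) =
      μ.prod (ρ ⊗ₘ κ).snd := by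
  have hm : Measurable fun q : (α × β) × γ => (q.1.1, q.2) := by fun_prop
  have := Measure.isProbabilityMeasure_map
    (μ := (μ.prod ρ) ⊗ₘ κ.comap Prod.snd measurable_snd) hm.aemeasurable
  refine Measure.ext_prod fun {s t} hs ht => ?_
  have h1 : (fun q : (α × β) × γ => (q.1.1, q.2)) ⁻¹' s ×ˢ t = (s ×ˢ Set.univ) ×ˢ t := by
    ext; simp
  rw [Measure.map_apply hm (hs.prod ht), h1,
    Measure.compProd_apply_prod (hs.prod MeasurableSet.univ) ht, ← Measure.prod_restrict,
    Measure.restrict_univ, Measure.prod_prod, Measure.snd_apply ht,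
    Measure.compProd_apply (measurable_snd ht),
    lintegral_prod _ ((κ.comap Prod.snd measurable_snd).measurable_coe ht).aemeasurable]
  simp only [Kernel.comap_apply, lintegral_const, Measure.restrict_apply_univ]
  rw [mul_comm]
  rfl

/-! ### Regret versus rate and distortion -/

namespace DataProcess

variable {Ω : Type v} [MeasurableSpace Ω] {P : Measure Ω} [IsProbabilityMeasure P]
  {Θ 𝒳 𝒴 : Type u} [MeasurableSpace Θ] [MeasurableSpace 𝒳] [MeasurableSpace 𝒴]
  {D : DataProcess P Θ 𝒳 𝒴} {W : Type*} [MeasurableSpace W] {Z : Ω × I → W}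

/-- The regret is at most the rate of a proxy plus the accumulated error of predictions that are
based on the proxy. -/
lemma IsProxy.regret_le [StandardBorelSpace 𝒴] [Nonempty 𝒴] (hZ : D.IsProxy Z)
    (κ : Kernel (W × 𝒳) 𝒴) [IsMarkovKernel κ] (T : ℕ) :
    D.regret T ≤ mutualInfo (extended P) (fun ω => D.E ω.1) Z +
      T * ∫⁻ ω, klDiv (D.target 0 ω.1) (κ (Z ω, D.X 0 ω.1)) ∂(extended P) := by
  set ν := P.map (D.X 0) with hν
  set ρ := (extended P).map (fun ω => (D.E ω.1, Z ω)) with hρ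
  set ρZ := (extended P).map Z with hρZ
  have hρp : IsProbabilityMeasure ρ :=
    Measure.isProbabilityMeasure_map hZ.measurable_E_Z.aemeasurable
  have hρZp : IsProbabilityMeasure ρZ :=
    Measure.isProbabilityMeasure_map hZ.measurable.aemeasurable
  have hρfst : ρ.map Prod.fst = P.map D.E := by
    rw [hρ, Measure.map_map measurable_fst hZ.measurable_E_Z, ← map_E_extended]
    rfl
  obtain ⟨π, hπ⟩ := exists_agent_dataKernel_eq ν ρZ (iidStep κ)
  set env' : Kernel ((Θ × W) × 𝒳) 𝒴 := D.env.comap (fun q => (q.1.1, q.2)) (by fun_prop)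
  set κ' : Kernel ((Θ × W) × 𝒳) 𝒴 := κ.comap (fun q => (q.1.2, q.2)) (by fun_prop)
  have henv : dataKernel ν (iidStep env') T =
      (dataKernel ν (iidStep D.env) T).comap Prod.fst measurable_fst :=
    dataKernel_comap ν (iidStep D.env) Prod.fst measurable_fst T
  have hκ : dataKernel ν (iidStep κ') T =
      (dataKernel ν (iidStep κ) T).comap Prod.snd measurable_snd :=
    dataKernel_comap ν (iidStep κ) Prod.snd measurable_snd T
  have hdrop : Measurable fun q : (Θ × W) × (Fin T → 𝒳 × 𝒴) => (q.1.1, q.2) := by fun_prop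
  have hA : (ρ ⊗ₘ dataKernel ν (iidStep env') T).map (fun q => (q.1.1, q.2)) =
      P.map D.E ⊗ₘ dataKernel ν (iidStep D.env) T := by
    rw [henv, ← hρfst, ← map_compProd_comap ρ measurable_fst]
    rfl
  -- In the reference law `E` is independent of `Z`, so forgetting `Z` leaves `E` independent of the
  -- mixture data, which is the data law of `π`.
  have hB : ((P.map D.E).prod ρZ ⊗ₘ dataKernel ν (iidStep κ') T).map (fun q => (q.1.1, q.2)) =
      P.map D.E ⊗ₘ dataKernel ν (agentStep Θ π) T := by
    have hc : dataKernel ν (agentStep Θ π) T =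
        Kernel.const Θ (ρZ ⊗ₘ dataKernel ν (iidStep κ) T).snd := by
      ext1 a
      rw [hπ, Kernel.const_apply]
    rw [hκ, map_prod_compProd_comap_snd, hc, Measure.compProd_const]
  have hterm (t : ℕ) : ∫⁻ q, klDiv (iidStep env' t q) (iidStep κ' t q)
      ∂((ρ ⊗ₘ dataKernel ν (iidStep env') t).prod ν) =
      ∫⁻ ω, klDiv (D.target 0 ω.1) (κ (Z ω, D.X 0 ω.1)) ∂(extended P) := by
    have hm : Measurable (Prod.map Prod.fst id :
        ((Θ × W) × (Fin t → 𝒳 × 𝒴)) × 𝒳 → (Θ × W) × 𝒳) := by fun_prop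
    rw [hZ.lintegral_klDiv_eq, ← hρ, ← hν]
    have hm2 : (ρ ⊗ₘ dataKernel ν (iidStep env') t).map Prod.fst = ρ := Measure.fst_compProd _ _
    have hm3 : ((ρ ⊗ₘ dataKernel ν (iidStep env') t).prod ν).map (Prod.map Prod.fst id) =
        ρ.prod ν := by
      rw [← Measure.map_prod_map _ _ measurable_fst measurable_id, hm2, Measure.map_id]
    rw [← hm3]
    exact (lintegral_map (measurable_klDiv env' κ') hm).symm
  calc D.regret T ≤ D.agentRegret π T := iInf_le _ π
    _ = klDiv (P.map D.E ⊗ₘ dataKernel ν (iidStep D.env) T)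
        (P.map D.E ⊗ₘ dataKernel ν (agentStep Θ π) T) := D.agentRegret_eq π T
    _ ≤ klDiv (ρ ⊗ₘ dataKernel ν (iidStep env') T)
        ((P.map D.E).prod ρZ ⊗ₘ dataKernel ν (iidStep κ') T) := by
      rw [← hA, ← hB]
      exact klDiv_map_le _ _ hdrop
    _ = klDiv ρ ((P.map D.E).prod ρZ) + T *
        ∫⁻ ω, klDiv (D.target 0 ω.1) (κ (Z ω, D.X 0 ω.1)) ∂(extended P) := by
      rw [klDiv_compProd_eq_add, klDiv_compProd_dataKernel, Finset.sum_congr rfl fun t _ => hterm t,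
        Finset.sum_const, Finset.card_range, nsmul_eq_mul]
    _ = _ := by rw [mutualInfo, map_E_extended]

/-- The conditional distribution that defines the distortion is the best prediction that is based
on the proxy. -/
lemma IsProxy.distortion_le [StandardBorelSpace 𝒴] [Nonempty 𝒴] (hZ : D.IsProxy Z)
    (κ : Kernel (W × 𝒳) 𝒴) [IsMarkovKernel κ] :
    D.distortion Z ≤ ∫⁻ ω, klDiv (D.target 0 ω.1) (κ (Z ω, D.X 0 ω.1)) ∂(extended P) := by
  have hg : Measurable fun q : (Θ × W) × 𝒳 => (q.1.2, q.2) := by fun_prop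
  have hmX : Measurable fun ω : Ω × I => D.X 0 ω.1 := (D.measurable_X 0).comp measurable_fst
  have hmY : Measurable fun ω : Ω × I => D.Y 1 ω.1 := (D.measurable_Y 1).comp measurable_fst
  have hmEZX : Measurable fun ω : Ω × I => ((D.E ω.1, Z ω), D.X 0 ω.1) :=
    hZ.measurable_E_Z.prodMk hmX
  have : IsProbabilityMeasure ((extended P).map (fun ω => (D.E ω.1, Z ω))) :=
    Measure.isProbabilityMeasure_map hZ.measurable_E_Z.aemeasurable
  rw [distortion, hZ.lintegral_klDiv_eq, hZ.lintegral_klDiv_eq]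
  set μ := ((extended P).map (fun ω => (D.E ω.1, Z ω))).prod (P.map (D.X 0)) with hμ
  set m := condDistrib (fun ω : Ω × I => D.Y 1 ω.1) (fun ω => (Z ω, D.X 0 ω.1)) (extended P)
  set env' : Kernel ((Θ × W) × 𝒳) 𝒴 := D.env.comap (fun q => (q.1.1, q.2)) (by fun_prop)
  have h (κ : Kernel (W × 𝒳) 𝒴) [IsMarkovKernel κ] :
      ∫⁻ q, klDiv (D.env (q.1.1, q.2)) (κ (q.1.2, q.2)) ∂μ =
        klDiv (μ ⊗ₘ env') (μ ⊗ₘ κ.comap _ hg) := (klDiv_compProd_right μ env' (κ.comap _ hg)).symm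
  -- With `μ` the law of `(E, Z, X)`, predictors based on `(Z, X)` are the kernels that factor
  -- through `g`, and `m` is the optimal one.
  rw [h, h]
  refine klDiv_compProd_comap_le μ hg _ m κ ?_
  have h1 : μ.map (fun q => (q.1.2, q.2)) = (extended P).map (fun ω => (Z ω, D.X 0 ω.1)) := by
    rw [hμ, ← hZ.map_E_Z_X, Measure.map_map hg hmEZX]
    rfl
  rw [h1, compProd_map_condDistrib hmY.aemeasurable, hμ, ← hZ.map_E_Z_X_Y,
    Measure.map_map (hg.prodMap measurable_id) (hmEZX.prodMk hmY)]
  rfl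

/-- A copy of the first `T` data pairs that is conditionally independent of the data given the
environment is a proxy whose rate and distortion are bounded by the regret. -/
lemma exists_proxy [StandardBorelSpace 𝒳] [StandardBorelSpace 𝒴] [Nonempty 𝒴]
    (D : DataProcess P Θ 𝒳 𝒴) (T : ℕ) :
    ∃ Z : Ω × I → (Fin T → 𝒳 × 𝒴), D.IsProxy Z ∧
      mutualInfo (extended P) (fun ω => D.E ω.1) Z ≤ D.regret T ∧
      T * D.distortion Z ≤ D.regret T := by
  have : Nonempty Ω := nonempty_of_isProbabilityMeasure P
  have : Nonempty 𝒳 := this.map (D.X 0)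
  set ν := P.map (D.X 0) with hν
  -- The copy is sampled from `E` and the auxiliary uniform variable; the observed data need not be
  -- conditionally independent of themselves given `E`.
  obtain ⟨f, hf, hfκ⟩ := (dataKernel ν (iidStep D.env) T).exists_measurable_map_eq_unitInterval
  have hmE : Measurable fun ω : Ω × I => D.E ω.1 := D.measurable_E.comp measurable_fst
  set Z : Ω × I → (Fin T → 𝒳 × 𝒴) := fun ω => f (D.E ω.1) ω.2 with hZdef
  have hZ : D.IsProxy Z :=
    ⟨hf.comp (hmE.prodMk measurable_snd),
      condIndepGiven_randomized D.measurable_E D.measurable_data hf _ hfκ⟩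
  set ρ := (extended P).map (fun ω => (D.E ω.1, Z ω)) with hρdef
  have hρ : ρ = P.map D.E ⊗ₘ dataKernel ν (iidStep D.env) T :=
    map_randomized D.measurable_E hf _ hfκ
  have hρp : IsProbabilityMeasure ρ :=
    Measure.isProbabilityMeasure_map hZ.measurable_E_Z.aemeasurable
  have hZp : IsProbabilityMeasure ((extended P).map Z) :=
    Measure.isProbabilityMeasure_map hZ.measurable.aemeasurable
  refine ⟨Z, hZ, le_iInf fun π => ?_, le_iInf fun π => ?_⟩
  -- The agent's data law ignores the environment, so it factors through a point. Among such
  -- constant kernels the marginal law of `Z` is optimal.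
  · have h1 : dataKernel ν (agentStep Θ π) T =
        (dataKernel ν (agentStep Unit π) T).comap (fun _ => ()) measurable_const :=
      dataKernel_comap ν (agentStep Unit π) (fun _ : Θ => ()) measurable_const T
    rw [D.agentRegret_eq, ← hν, ← hρ, h1, mutualInfo, map_E_extended, ← Measure.compProd_const]
    refine klDiv_compProd_comap_le (P.map D.E) measurable_const ρ
      (Kernel.const Unit ((extended P).map Z)) (dataKernel ν (agentStep Unit π) T) ?_
    rw [Measure.compProd_const, Measure.map_const, measure_univ, one_smul, Measure.dirac_prod,
      Measure.map_map measurable_prodMk_left hZ.measurable, hρdef,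
      Measure.map_map (measurable_const.prodMap measurable_id) hZ.measurable_E_Z]
    rfl
  · have hterm : ∀ t ∈ Finset.range T, D.distortion Z ≤
        ∫⁻ q, klDiv (iidStep D.env t q) (agentStep Θ π t q)
          ∂((P.map D.E ⊗ₘ dataKernel ν (iidStep D.env) t).prod ν) := by
      intro t ht
      have htT : t ≤ T := (Finset.mem_range.1 ht).le
      have := π.predict_markov t
      -- Feeding the agent the first `t` pairs of `Z`, with `X 0` as current input, reproduces its
      -- round-`t` error and is one of the predictors that `distortion_le` beats.
      let r : (Fin T → 𝒳 × 𝒴) → (Fin t → 𝒳 × 𝒴) := fun h i => h (Fin.castLE htT i)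
      have hr : Measurable r := by fun_prop
      refine (hZ.distortion_le ((π.predict t).comap (Prod.map r id) (by fun_prop))).trans
        (le_of_eq ?_)
      have h2 : (ρ.map (Prod.map id r)) = P.map D.E ⊗ₘ dataKernel ν (iidStep D.env) t := by
        rw [hρ, ← D.map_E_pairs, ← D.map_E_pairs, Measure.map_map (by fun_prop)
          (D.measurable_E.prodMk (D.measurable_pairs T))]
        rfl
      have h3 : (ρ.prod ν).map (Prod.map (Prod.map id r) id) =
          (P.map D.E ⊗ₘ dataKernel ν (iidStep D.env) t).prod ν := by
        rw [← Measure.map_prod_map _ _ (by fun_prop) measurable_id, h2, Measure.map_id]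
      rw [hZ.lintegral_klDiv_eq, ← hρdef, ← hν, ← h3]
      have hm : Measurable (Prod.map (Prod.map id r) id : (Θ × (Fin T → 𝒳 × 𝒴)) × 𝒳 → _) := by
        fun_prop
      exact (lintegral_map (measurable_klDiv (iidStep D.env t) (agentStep Θ π t)) hm).symm
    rw [D.agentRegret_eq, ← hν, klDiv_compProd_dataKernel]
    simpa using Finset.card_nsmul_le_sum _ _ _ hterm

variable [StandardBorelSpace 𝒴] [Nonempty 𝒴] (D)

lemma regret_le_rateDistortion_add (ε : ℝ≥0) (T : ℕ) :
    D.regret T ≤ D.rateDistortion ε + T * ε := by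
  rw [rateDistortion]
  simp only [ENNReal.iInf_add]
  refine le_iInf fun W => le_iInf fun _ => le_iInf fun Z => le_iInf fun hZ => le_iInf fun hε => ?_
  refine (hZ.regret_le (condDistrib (fun ω : Ω × I => D.Y 1 ω.1)
    (fun ω => (Z ω, D.X 0 ω.1)) (extended P)) T).trans ?_
  gcongr
  exact hε

lemma rateDistortion_le_regret [StandardBorelSpace 𝒳] (ε : ℝ≥0) {T : ℕ} (hT : 1 ≤ T)
    (h : D.regret T / T ≤ ε) : D.rateDistortion ε ≤ D.regret T := by
  obtain ⟨Z, hZ, h1, h2⟩ := D.exists_proxy T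
  refine le_trans ?_ h1
  refine iInf_le_of_le _ (iInf_le_of_le _ (iInf_le_of_le Z (iInf_le_of_le hZ
    (iInf_le_of_le ?_ le_rfl))))
  refine le_trans ?_ h
  rw [ENNReal.le_div_iff_mul_le (Or.inl (by positivity)) (Or.inl (ENNReal.natCast_ne_top T)),
    mul_comm]
  exact h2

end DataProcess

end RateDistortion

/-! ### The sample complexity bounds -/

theorem mainTheorem4 {Ω : Type v} [MeasurableSpace Ω] (P : Measure Ω)
    [IsProbabilityMeasure P] {Θ 𝒳 𝒴 : Type u} [MeasurableSpace Θ]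
    [MeasurableSpace 𝒳] [StandardBorelSpace 𝒳]
    [MeasurableSpace 𝒴] [StandardBorelSpace 𝒴] [Nonempty 𝒴]
    (D : RateDistortion.DataProcess P Θ 𝒳 𝒴) (ε : ℝ≥0) :
    D.rateDistortion ε / (ε : ℝ≥0∞) ≤ (D.sampleComplexity ε : ℝ≥0∞) ∧
    D.sampleComplexity ε ≤
      max 1 (⨅ δ ∈ Set.Icc (0 : ℝ≥0) ε, ⌈D.rateDistortion (ε - δ) / (δ : ℝ≥0∞)⌉ₑ) ∧
    (⨅ δ ∈ Set.Icc (0 : ℝ≥0) ε, ⌈D.rateDistortion (ε - δ) / (δ : ℝ≥0∞)⌉ₑ) ≤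
      ⌈2 * D.rateDistortion (ε / 2) / (ε : ℝ≥0∞)⌉ₑ := by
  refine ⟨?_, ?_, ?_⟩
  · rcases Set.eq_empty_or_nonempty
      {N : ℕ∞ | ∃ T : ℕ, N = T ∧ 1 ≤ T ∧ D.regret T / T ≤ ε} with hS | hS
    · rw [RateDistortion.DataProcess.sampleComplexity, hS, sInf_empty]
      simp
    · obtain ⟨T, hTeq, hT, hR⟩ := csInf_mem hS
      rw [RateDistortion.DataProcess.sampleComplexity, hTeq]
      refine ENNReal.div_le_of_le_mul ?_
      refine (D.rateDistortion_le_regret ε hT hR).trans ?_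
      rw [mul_comm]
      refine (ENNReal.div_le_iff_le_mul (Or.inl (by positivity))
        (Or.inl (ENNReal.natCast_ne_top T))).1 hR
  · simp only [sup_iInf_eq]
    refine le_iInf fun δ => le_iInf fun hδ => ?_
    set a := D.rateDistortion (ε - δ) / (δ : ℝ≥0∞) with ha
    rcases eq_or_ne a ⊤ with htop | htop
    · simp [htop]
    obtain ⟨n, hn⟩ := ENat.ne_top_iff_exists.1 (mt ENat.ceil_eq_top.1 htop)
    have han : a ≤ ((max 1 n : ℕ) : ℝ≥0∞) := by
      have h1 : a ≤ ((n : ℕ∞) : ℝ≥0∞) := by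
        rw [hn]
        exact ENat.le_ceil_self
      refine h1.trans ?_
      rw [ENat.toENNReal_coe]
      exact Nat.cast_le.2 (le_max_right 1 n)
    -- The maximum is needed because `n = 0` when the rate-distortion value vanishes, while
    -- durations start at 1.
    set T := max 1 n with hT
    have hT0 : (T : ℝ≥0∞) ≠ 0 := by
      have : 1 ≤ T := le_max_left _ _
      positivity
    -- This includes `δ = 0`: a finite quotient then forces the numerator to be zero.
    rw [ENNReal.div_le_iff_le_mul (Or.inr (ENNReal.natCast_ne_top T))
      (Or.inl ENNReal.coe_ne_top)] at han
    have hreg : D.regret T ≤ ε * T := by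
      refine (D.regret_le_rateDistortion_add (ε - δ) T).trans ((add_le_add_left han _).trans ?_)
      rw [← mul_add, ← ENNReal.coe_add, add_tsub_cancel_of_le hδ.2, mul_comm]
    have hmem : (T : ℕ∞) ∈ {N : ℕ∞ | ∃ T : ℕ, N = T ∧ 1 ≤ T ∧ D.regret T / T ≤ ε} :=
      ⟨T, rfl, le_max_left _ _,
        (ENNReal.div_le_iff_le_mul (Or.inl hT0) (Or.inl (ENNReal.natCast_ne_top T))).2 hreg⟩
    refine (sInf_le hmem).trans (le_of_eq ?_)
    rw [← hn, hT]
    norm_cast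
  · refine iInf₂_le_of_le (ε / 2) ⟨zero_le, half_le_self zero_le⟩ (ENat.ceil_mono (le_of_eq ?_))
    rw [show ε - ε / 2 = ε / 2 from tsub_eq_of_eq_add (add_halves ε).symm, ENNReal.coe_div (by simp),
      div_eq_mul_inv, ENNReal.inv_div (Or.inl (by simp)) (Or.inl (by simp)), ENNReal.coe_ofNat,
      ← mul_div_assoc, mul_comm]
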